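/- Let $m\ge 1$ and consider the nonlinear equation with distributed delays $$\dot x(t)+f(t,x(t))+\sum_{k=1}^m\int_{[h_k(t),t]} g_k(t,x(s))\,d_sR_k(t,s)=0,\quad t\ge 0,\qquad x(t)=\varphi(t),\quad t\le 0,$$ where the integrals are Lebesgue–Stieltjes integrals. A solution is a function on $\mathbb R$ that equals $\varphi$ on $(-\infty,0]$, is absolutely continuous on every interval $[0,T]$ and satisfies the equation for almost every $t\ge 0$. Assume the following. (i) Each $h_k$ is Lebesgue measurable on $[0,\infty)$, $h_k(t)\le t$, $\lim_{t\to\infty}h_k(t)=\infty$, and $t-h_k(t)\le h_0$ for all $t\ge 0$. (ii) For each $k$ and almost every $t\ge 0$, the function $s\mapsto R_k(t,s)$ is nondecreasing on $\mathbb R$ and the measure $d_sR_k(t,\cdot)$ has mass at most $1$ on $[\max\{0,h_k(t)\},t]$. (This holds in particular if $\int_{[h_k(t),t]}d_sR_k(t,s)=1$, and also if $\int_{[0,t]}d_sR_k(t,s)=1$.) (iii) The functions $f$ and $g_k$ are continuous on $[0,\infty)\times\mathbb R$, $f(t,0)=g_k(t,0)=0$, and $f(t,u)u>0$, $g_k(t,u)u>0$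 for all $t\ge 0$ and $u\ne 0$. (iv) There are $-\infty\le x_1^0\le 0\le x_2^0\le\infty$ and $-\infty<x_1\le 0\le x_2<\infty$ such that for every bounded continuous $\varphi:(-\infty,0]\to\mathbb R$ with $x_1^0\le\varphi\le x_2^0$ the problem has a unique global solution $x$, and $x_1\le x(t)\le x_2$ for all sufficiently large $t$ (in particular, this is so if these bounds hold for all $t\ge 0$). (v) There are positive numbers $a_0,A,b_1,\dots,b_m$ such that for all $t\ge0$, all $k$ and all $u\in[x_1,x_2]$, $u\ne 0$, $$a_0\le\frac{f(t,u)}{u}\le A,\qquad 0\le\frac{g_k(t,u)}{u}\le b_k,$$ and, with $b_0=\sum_{k=1}^m b_k$, $$\frac{a_0}{b_0}e^{-Ah_0}>\ln\frac{b_0^2+a_0b_0}{b_0^2+a_0^2}.$$ Then for every bounded continuous $\varphi:(-\infty,0]\to\mathbb R$ with $x_1^0\le\varphi\le x_2^0$, every solution $x$ of the problem satisfies $\lim_{t\to\infty}x(t)=0$. -/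

import Mathlib

open MeasureTheory Set Filter Topology

/-- The Lebesgue-Stieltjes measure `d r` of a nondecreasing function `r : ℝ → ℝ`, so that
`d r [a, b] = r (b+) - r (a-)`. (It is set to `0` if `r` is not nondecreasing.) -/
noncomputable def lebesgueStieltjes (r : ℝ → ℝ) : Measure ℝ :=
  open Classical in if hr : Monotone r then hr.stieltjesFunction.measure else 0

/-- `h` is a delayed argument on `[0, ∞)`: it is Lebesgue measurable there, `h t ≤ t`,
and `h t → ∞` as `t → ∞`. -/
structure IsDelayedArgument (h : ℝ → ℝ) : Prop where
  measurable : AEMeasurable h (volume.restrict (Ici 0))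
  le_self : ∀ t, 0 ≤ t → h t ≤ t
  tendsto : Tendsto h atTop atTop

/-- The nonlinearity `f (t, u)`, `t ≥ 0`, `u ∈ ℝ`, is continuous, vanishes at `u = 0` and has
the sign of `u`. -/
structure IsSignPreserving (f : ℝ → ℝ → ℝ) : Prop where
  continuousOn : ContinuousOn (fun p : ℝ × ℝ => f p.1 p.2) (Ici 0 ×ˢ univ)
  zero : ∀ t, 0 ≤ t → f t 0 = 0
  pos : ∀ t, 0 ≤ t → ∀ u, u ≠ 0 → 0 < f t u * u

/-- Admissible initial functions: bounded continuous `φ` on `(-∞, 0]` with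
`lo ≤ φ ≤ hi`, where `lo` and `hi` may be infinite. Values of `φ` on `(0, ∞)` play no role. -/
structure IsAdmissibleInitial (lo hi : EReal) (φ : ℝ → ℝ) : Prop where
  continuousOn : ContinuousOn φ (Iic 0)
  bounded : ∃ C : ℝ, ∀ t, t ≤ 0 → |φ t| ≤ C
  mem_range : ∀ t, t ≤ 0 → lo ≤ (φ t : EReal) ∧ (φ t : EReal) ≤ hi

/-- `x` is a global solution of
`x'(t) + f (t, x t) + ∑ k, ∫_{[h k t, t]} g k (t, x s) d_s R k (t, s) = 0` for `t ≥ 0`,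
with `x t = φ t` for `t ≤ 0`: it is absolutely continuous on every interval `[0, T]`
and satisfies the equation almost everywhere. -/
structure IsSolution {m : ℕ} (f : ℝ → ℝ → ℝ) (g : Fin m → ℝ → ℝ → ℝ) (h : Fin m → ℝ → ℝ)
    (R : Fin m → ℝ → ℝ → ℝ) (φ x : ℝ → ℝ) : Prop where
  initial : ∀ t, t ≤ 0 → x t = φ t
  absolutelyContinuous : ∀ T, 0 ≤ T → AbsolutelyContinuousOnInterval x 0 T
  equation : ∀ᵐ t ∂(volume.restrict (Ici (0 : ℝ))), ∃ x' : ℝ, HasDerivAt x x' t ∧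
    x' + f t (x t)
      + ∑ k, ∫ s in Icc (h k t) t, g k t (x s) ∂(lebesgueStieltjes (R k t)) = 0

/-! Write `f (t, x) = a(t) x` with `a₀ ≤ a ≤ A` and use the time `τ = ∫ a`: the delay is then at
most `A h₀`, and a lower bound `-c` for `x` on the delay window makes `x` decay towards `β c` or
below, where `β = b₀ / a₀`. A nonoscillating solution decays like `e ^ (-τ)`.

Suppose `x` has arbitrarily late zeros and `|x| ≤ m` eventually. On a positive hump starting at a
zero `s`, the delayed values are bounded below by `-m`. Before `s` they also exceed `-β m (e ^ (τ s
- τ u) - 1)`, because `x` must climb back to `0` at `s`. Using the better bound on each piece of the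
hump gives `x ≤ K m` with `K = (β² + β) e ^ (-ε) - β²` (`hump_bound`), and the hypothesis on `A h₀`
says exactly that `K < 1` when `ε = e ^ (-A h₀) / β`. Beyond delay `h₀` a hump only decreases
(`le_contraction_mul`). The same holds for `-x`, so `|x|` is eventually at most `max K 0 * m`;
iterate. -/

/-! ### Weighted differential inequalities -/

/-- An absolutely continuous function whose derivative is a.e. nonpositive does not increase. -/
theorem AbsolutelyContinuousOnInterval.le_of_ae_hasDerivAt_nonpos {w : ℝ → ℝ} {s t : ℝ}
    (hst : s ≤ t) (hw : AbsolutelyContinuousOnInterval w s t)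
    (hd : ∀ᵐ r, r ∈ Icc s t → ∃ w' : ℝ, HasDerivAt w w' r ∧ w' ≤ 0) : w t ≤ w s := by
  have h1 := hw.integral_deriv_eq_sub
  have h2 : ∫ r in s..t, deriv w r ≤ 0 := by
    rw [intervalIntegral.integral_of_le hst]
    apply setIntegral_nonpos_ae measurableSet_Ioc
    filter_upwards [hd] with r hr hmem
    obtain ⟨w', h, h'⟩ := hr ⟨hmem.1.le, hmem.2⟩
    rwa [h.deriv]
  linarith

theorem LipschitzWith.absolutelyContinuousOnInterval_exp {τ : ℝ → ℝ} {L : NNReal}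
    (hτ : LipschitzWith L τ) (s t : ℝ) :
    AbsolutelyContinuousOnInterval (fun r => Real.exp (τ r)) s t := by
  have hcomp : IsCompact (τ '' uIcc s t) := isCompact_uIcc.image hτ.continuous
  obtain ⟨c, d, hcd⟩ : ∃ c d, τ '' uIcc s t ⊆ Icc c d :=
    ⟨_, _, hcomp.isBounded.subset_Icc_sInf_sSup⟩
  obtain ⟨K, hK⟩ := (Real.contDiff_exp (n := 1)).contDiffOn.exists_lipschitzOnWith
    (by decide) (convex_Icc c d) isCompact_Icc
  exact (hK.comp hτ.lipschitzOnWith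
    (fun r hr => hcd (mem_image_of_mem τ hr))).absolutelyContinuousOnInterval

/-- If `x' = -a x - F` and `τ' = a` a.e., then `e ^ τ (x - p) - q τ` does not increase as long as
`-F ≤ a (p + q e ^ (-τ))`. -/
theorem exp_weighted_le {x τ a F : ℝ → ℝ} {L : NNReal} {p q s t : ℝ} (hst : s ≤ t)
    (hx : AbsolutelyContinuousOnInterval x s t) (hτ : LipschitzWith L τ)
    (hτ' : ∀ᵐ r, HasDerivAt τ (a r) r)
    (hx' : ∀ᵐ r, r ∈ Icc s t → HasDerivAt x (-(a r * x r) - F r) r)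
    (hF : ∀ᵐ r, r ∈ Icc s t → -F r ≤ a r * (p + q * Real.exp (-τ r))) :
    Real.exp (τ t) * (x t - p) - q * τ t ≤ Real.exp (τ s) * (x s - p) - q * τ s := by
  have hc : AbsolutelyContinuousOnInterval (fun _ : ℝ => p) s t :=
    (LipschitzWith.const p).lipschitzOnWith.absolutelyContinuousOnInterval
  have hE := hτ.absolutelyContinuousOnInterval_exp s t
  have hw : AbsolutelyContinuousOnInterval
      (fun r => Real.exp (τ r) * (x r - p) - q * τ r) s t :=
    (hE.mul (hx.sub hc)).sub
      (hτ.lipschitzOnWith.absolutelyContinuousOnInterval.const_mul q)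
  refine hw.le_of_ae_hasDerivAt_nonpos hst ?_
  filter_upwards [hτ', hx', hF] with r h1 h2 h3 hr
  refine ⟨_, (h1.exp.mul ((h2 hr).sub_const p)).sub (h1.const_mul q), ?_⟩
  have h4 := mul_le_mul_of_nonneg_left (h3 hr) (Real.exp_pos (τ r)).le
  have h5 : Real.exp (τ r) * Real.exp (-τ r) = 1 := by rw [← Real.exp_add]; simp
  have h6 : Real.exp (τ r) * (a r * (p + q * Real.exp (-τ r)))
      = Real.exp (τ r) * a r * p + q * a r := by
    linear_combination a r * q * h5
  nlinarith [h4, h6]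

/-- The data of a scalar comparison problem with delay at most `h₀` on `[T₀, ∞)`, after the
change of time `τ`: wherever the delayed term is controlled by a lower bound `-c` of `x`, the
corresponding weighted function does not increase. -/
structure IsDelayComparable (x τ : ℝ → ℝ) (a₀ A b₀ h₀ T₀ : ℝ) : Prop where
  continuousOn : ContinuousOn x (Ici T₀)
  time_lower : ∀ s t, s ≤ t → a₀ * (t - s) ≤ τ t - τ s
  time_upper : ∀ s t, s ≤ t → τ t - τ s ≤ A * (t - s)
  time_continuous : Continuous τ
  weighted_le : ∀ p q s t, T₀ + h₀ ≤ s → s ≤ t →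
    (∀ r ∈ Icc s t, ∃ c, 0 ≤ c ∧ (∀ u ∈ Icc (r - h₀) r, -c ≤ x u) ∧
      b₀ * c ≤ a₀ * (p + q * Real.exp (-τ r))) →
    Real.exp (τ t) * (x t - p) - q * τ t ≤ Real.exp (τ s) * (x s - p) - q * τ s

/-! ### The contraction constant -/

/-- The contraction factor is smaller than one. -/
theorem contraction_factor_lt_one {β ε : ℝ} (hβ : 0 < β)
    (h : Real.log ((β ^ 2 + β) / (β ^ 2 + 1)) < ε) :
    (β ^ 2 + β) * Real.exp (-ε) - β ^ 2 < 1 := by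
  have h1 : (β ^ 2 + β) / (β ^ 2 + 1) < Real.exp ε := by
    rw [← Real.log_lt_iff_lt_exp (by positivity)]; exact h
  rw [div_lt_iff₀ (by positivity)] at h1
  have h2 : (β ^ 2 + β) * Real.exp (-ε) < β ^ 2 + 1 := by
    rw [Real.exp_neg, ← div_eq_mul_inv, div_lt_iff₀ (Real.exp_pos _)]
    linarith
  linarith

/-- The condition on the delay still holds when the delay is enlarged to `log (1 + 1 / β)`. -/
theorem log_lt_exp_neg_max {β D : ℝ} (hβ : 0 < β)
    (h : Real.log ((β ^ 2 + β) / (β ^ 2 + 1)) < Real.exp (-D) / β) :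
    Real.log ((β ^ 2 + β) / (β ^ 2 + 1)) < Real.exp (-max D (Real.log (1 + 1 / β))) / β := by
  rcases max_cases D (Real.log (1 + 1 / β)) with ⟨he, -⟩ | ⟨he, -⟩
  · rwa [he]
  · rw [he, Real.exp_neg, Real.exp_log (by positivity)]
    -- With the enlarged delay the right side is `1 / (β + 1)`, and `log y ≤ y - 1` suffices because
    -- `(β - 1)(β + 1) < β² + 1`.
    have h1 := Real.log_le_sub_one_of_pos (x := (β ^ 2 + β) / (β ^ 2 + 1)) (by positivity)
    refine h1.trans_lt ?_
    have h2 : (β ^ 2 + β) / (β ^ 2 + 1) - 1 = (β - 1) / (β ^ 2 + 1) := by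
      field_simp; ring
    have h3 : (1 + 1 / β)⁻¹ / β = 1 / (β + 1) := by field_simp
    rw [h2, h3, div_lt_div_iff₀ (by positivity) (by positivity)]
    nlinarith

/-! ### Humps, contraction and convergence for the comparison problem -/

namespace IsDelayComparable

variable {x τ : ℝ → ℝ} {a₀ A b₀ h₀ T₀ : ℝ}

/-- Read forwards from a zero this bounds `x` above; read backwards from a zero it bounds `x` below.
-/
theorem le_of_neg_le (hx : IsDelayComparable x τ a₀ A b₀ h₀ T₀) (ha : 0 < a₀) {T c s t : ℝ}
    (hT : T₀ ≤ T) (hc : 0 ≤ c) (hlow : ∀ u, T ≤ u → -c ≤ x u) (hs : T + h₀ ≤ s) (hst : s ≤ t) :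
    Real.exp (τ t) * (x t - b₀ / a₀ * c) ≤ Real.exp (τ s) * (x s - b₀ / a₀ * c) := by
  have := hx.weighted_le (b₀ / a₀ * c) 0 s t (by linarith) hst (fun r hr =>
    ⟨c, hc, fun u hu => hlow u (by linarith [hu.1, hr.1]), by
      have : a₀ * (b₀ / a₀ * c) = b₀ * c := by field_simp
      simp [this]⟩)
  simpa using this

theorem exp_mul_le_of_nonneg (hx : IsDelayComparable x τ a₀ A b₀ h₀ T₀) {s t : ℝ}
    (hs : T₀ + h₀ ≤ s) (hst : s ≤ t) (hpos : ∀ u ∈ Icc (s - h₀) t, 0 ≤ x u) :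
    Real.exp (τ t) * x t ≤ Real.exp (τ s) * x s := by
  have := hx.weighted_le 0 0 s t hs hst (fun r hr =>
    ⟨0, le_rfl, fun u hu => by
      simpa using hpos u ⟨by linarith [hu.1, hr.1], hu.2.trans hr.2⟩, by simp⟩)
  simpa using this

theorem time_mono (hx : IsDelayComparable x τ a₀ A b₀ h₀ T₀) (ha : 0 < a₀) : Monotone τ := by
  intro s t hst
  have := hx.time_lower s t hst
  nlinarith [mul_nonneg ha.le (sub_nonneg.2 hst)]

/-- Bound for a positive hump of length at most `h₀` that starts at a zero `s`. -/
theorem hump_bound (hx : IsDelayComparable x τ a₀ A b₀ h₀ T₀) (ha : 0 < a₀) (hA : 0 < A)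
    (hb : 0 < b₀) {T m s t H β ε : ℝ} (hβ : β = b₀ / a₀)
    (hH : H = max (A * h₀) (Real.log (1 + 1 / β))) (hε : ε = Real.exp (-H) / β)
    (hT : T₀ ≤ T) (hm : 0 ≤ m) (hlow : ∀ u, T ≤ u → -m ≤ x u) (hs : T + 2 * h₀ ≤ s)
    (h₀0 : 0 ≤ h₀) (hst : s ≤ t) (hts : t ≤ s + h₀) (hxs : x s = 0)
    (hpos : ∀ u ∈ Icc s t, 0 ≤ x u) :
    x t ≤ ((β ^ 2 + β) * Real.exp (-ε) - β ^ 2) * m := by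
  have hβ0 : 0 < β := hβ ▸ div_pos hb ha
  have hDH : A * h₀ ≤ H := hH ▸ le_max_left _ _
  have hvH : Real.log (1 + 1 / β) ≤ H := hH ▸ le_max_right _ _
  have hab : a₀ * β = b₀ := by rw [hβ]; field_simp
  -- At `τ`-distance `v` before the zero the backward bound `β m (e ^ v - 1)` equals `m`. Hence `-m`
  -- is the better bound until `τ` has advanced by `H - v`, which `H ≥ v` makes nonnegative.
  set v := Real.log (1 + 1 / β) with hv
  have hexpv : Real.exp v = 1 + 1 / β := Real.exp_log (by positivity)
  have hr1 : Real.exp (-(H - v)) = (1 + β) * ε := by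
    rw [neg_sub, sub_eq_add_neg, Real.exp_add, hexpv, hε]; field_simp; ring
  have hε1 : 1 - ε ≤ Real.exp (-ε) := by linarith [Real.add_one_le_exp (-ε)]
  have hfirst : ∀ u, s ≤ u → x u ≤ β * m * (1 - Real.exp (-(τ u - τ s))) := by
    intro u hu
    have h := hx.le_of_neg_le ha hT hm hlow (by linarith) hu
    rw [hxs, ← hβ] at h
    have h2 : Real.exp (τ s) = Real.exp (τ u) * Real.exp (-(τ u - τ s)) := by
      rw [← Real.exp_add]; ring_nf
    rw [h2, mul_assoc] at h
    have := le_of_mul_le_mul_left h (Real.exp_pos _)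
    linarith
  by_cases hcase : τ t - τ s ≤ H - v
  · refine (hfirst t hst).trans ?_
    have h1 : (1 + β) * ε ≤ Real.exp (-(τ t - τ s)) := by
      rw [← hr1]; exact Real.exp_le_exp.2 (by linarith)
    have h2 : 1 - Real.exp (-(τ t - τ s)) ≤ (1 + β) * Real.exp (-ε) - β := by nlinarith
    calc β * m * (1 - Real.exp (-(τ t - τ s)))
        ≤ β * m * ((1 + β) * Real.exp (-ε) - β) := by gcongr
      _ = _ := by ring
  · push Not at hcase
    obtain ⟨t₁, ⟨hst₁, ht₁t⟩, ht₁⟩ : ∃ t₁ ∈ Icc s t, τ t₁ = τ s + (H - v) :=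
      intermediate_value_Icc hst hx.time_continuous.continuousOn ⟨by linarith, by linarith⟩
    have hx₁ := hfirst t₁ hst₁
    rw [show τ t₁ - τ s = H - v by linarith, hr1] at hx₁
    have hback : ∀ u, T + h₀ ≤ u → u ≤ s → -(β * m * (Real.exp (τ s - τ u) - 1)) ≤ x u := by
      intro u hu hus
      have h := hx.le_of_neg_le ha hT hm hlow hu hus
      rw [hxs, ← hβ, show τ s = τ u + (τ s - τ u) by ring, Real.exp_add, mul_assoc] at h
      have := le_of_mul_le_mul_left h (Real.exp_pos _)
      linarith
    -- From `t₁` on, the backward bound is used at the largest possible delay `H`. Multiplied by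
    -- `β`, it has the form `p + q e ^ (-τ r)` with these `p` and `q`.
    have hsecond := hx.weighted_le (-(β ^ 2 * m)) (β ^ 2 * m * Real.exp (H + τ s)) t₁ t
      (by linarith) ht₁t (fun r hr => by
        have hsr : s ≤ r := hst₁.trans hr.1
        refine ⟨β * m * (Real.exp (H + τ s - τ r) - 1), ?_, ?_, ?_⟩
        · have h1 := hx.time_upper s r hsr
          have h2 : A * (r - s) ≤ A * h₀ := by gcongr; linarith [hr.2]
          have : 1 ≤ Real.exp (H + τ s - τ r) := Real.one_le_exp (by linarith)
          have : 0 ≤ Real.exp (H + τ s - τ r) - 1 := by linarith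
          positivity
        · intro u hu
          have h1 := hx.time_upper u r hu.2
          have h2 : A * (r - u) ≤ A * h₀ := by gcongr; linarith [hu.1]
          have h3 : Real.exp (τ s - τ u) ≤ Real.exp (H + τ s - τ r) :=
            Real.exp_le_exp.2 (by linarith)
          rcases le_total s u with hsu | hus
          · have h4 := hpos u ⟨hsu, hu.2.trans hr.2⟩
            have h5 := hx.time_upper s r hsr
            have h6 : A * (r - s) ≤ A * h₀ := by gcongr; linarith [hr.2]
            have : 1 ≤ Real.exp (H + τ s - τ r) := Real.one_le_exp (by linarith)
            have : 0 ≤ Real.exp (H + τ s - τ r) - 1 := by linarith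
            have : 0 ≤ β * m * (Real.exp (H + τ s - τ r) - 1) := by positivity
            linarith
          · refine le_trans ?_ (hback u (by linarith [hu.1]) hus)
            gcongr
        · rw [sub_eq_add_neg (H + τ s), Real.exp_add, ← hab]
          apply le_of_eq; ring)
    -- divide by `exp (τ t)`
    set q := τ t - τ t₁ with hq
    have e1 : Real.exp (τ t₁) = Real.exp (τ t) * Real.exp (-q) := by
      rw [← Real.exp_add]; congr 1; rw [hq]; ring
    have e2 : Real.exp (H + τ s) = Real.exp (τ t) * ((1 + 1 / β) * Real.exp (-q)) := by
      rw [← hexpv, ← Real.exp_add, ← Real.exp_add]; congr 1; rw [hq]; linarith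
    rw [e1, e2] at hsecond
    have h1 : Real.exp (τ t) * (x t + β ^ 2 * m) ≤ Real.exp (τ t) *
        (Real.exp (-q) * (x t₁ + β ^ 2 * m + (β ^ 2 + β) * m * q)) := by
      have h2 : β ^ 2 * (1 + 1 / β) = β ^ 2 + β := by field_simp
      have h3 : τ t = τ t₁ + q := by rw [hq]; ring
      linear_combination hsecond + m * (Real.exp (τ t) * Real.exp (-q)) * (τ t - τ t₁) * h2
        + m * (Real.exp (τ t) * Real.exp (-q)) * (β ^ 2 + β) * h3
    have h2 := le_of_mul_le_mul_left h1 (Real.exp_pos _)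
    have h3 : Real.exp (-q) * (x t₁ + β ^ 2 * m + (β ^ 2 + β) * m * q)
        ≤ Real.exp (-q) * ((β ^ 2 + β) * m * (1 + (q - ε))) := by
      gcongr; nlinarith [hx₁]
    -- The left side is largest at `q = ε`, so the length of the second piece drops out.
    have h4 : Real.exp (-q) * (1 + (q - ε)) ≤ Real.exp (-ε) := by
      calc _ ≤ Real.exp (-q) * Real.exp (q - ε) := by
            gcongr; linarith [Real.add_one_le_exp (q - ε)]
        _ = _ := by rw [← Real.exp_add]; ring_nf
    have h5 := mul_le_mul_of_nonneg_left h4 (show 0 ≤ (β ^ 2 + β) * m by positivity)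
    linarith

/-- After a zero, a lower bound `-m` forces the upper bound `max K 0 * m`. -/
theorem le_contraction_mul (hx : IsDelayComparable x τ a₀ A b₀ h₀ T₀) (ha : 0 < a₀) (hA : 0 < A)
    (hb : 0 < b₀) {T m s₀ H β ε : ℝ} (hβ : β = b₀ / a₀)
    (hH : H = max (A * h₀) (Real.log (1 + 1 / β))) (hε : ε = Real.exp (-H) / β)
    (hT : T₀ ≤ T) (hm : 0 ≤ m) (hlow : ∀ u, T ≤ u → -m ≤ x u) (hs₀ : T + 2 * h₀ ≤ s₀)
    (h₀0 : 0 ≤ h₀) (hxs₀ : x s₀ = 0) {t : ℝ} (ht : s₀ ≤ t) :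
    x t ≤ max ((β ^ 2 + β) * Real.exp (-ε) - β ^ 2) 0 * m := by
  rcases le_or_gt (x t) 0 with h | hxt
  · exact h.trans (by positivity)
  have hcont : ContinuousOn x (Icc s₀ t) :=
    hx.continuousOn.mono fun u hu => by
      have := hu.1
      simp only [mem_Ici]; linarith
  -- The last zero before `t` starts the hump containing `t`.
  obtain ⟨s, ⟨⟨hs, hst⟩, hxs⟩, hgr⟩ : ∃ s, IsGreatest (Icc s₀ t ∩ x ⁻¹' {0}) s :=
    (isCompact_Icc.of_isClosed_subset
      (hcont.preimage_isClosed_of_isClosed isClosed_Icc isClosed_singleton)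
      inter_subset_left).exists_isGreatest ⟨s₀, ⟨le_rfl, ht⟩, hxs₀⟩
  have hxs : x s = 0 := hxs
  have hpos : ∀ u ∈ Icc s t, 0 ≤ x u := by
    intro u hu
    by_contra! hneg
    obtain ⟨z, hz, hz0⟩ := intermediate_value_Icc hu.2
      (hcont.mono (Icc_subset_Icc_left (hs.trans hu.1))) ⟨hneg.le, hxt.le⟩
    have h1 : z ≤ s := hgr ⟨⟨hs.trans (hu.1.trans hz.1), hz.2⟩, hz0⟩
    have h2 : u = s := le_antisymm (hz.1.trans h1) hu.1
    rw [h2, hxs] at hneg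
    exact lt_irrefl _ hneg
  have key : ∀ r, s ≤ r → r ≤ t → r ≤ s + h₀ →
      x r ≤ max ((β ^ 2 + β) * Real.exp (-ε) - β ^ 2) 0 * m := fun r hr hrt hrs =>
    (hx.hump_bound ha hA hb hβ hH hε hT hm hlow (hs₀.trans hs) h₀0 hr hrs hxs
      (fun u hu => hpos u ⟨hu.1, hu.2.trans hrt⟩)).trans (by gcongr; exact le_max_left _ _)
  rcases le_total t (s + h₀) with hle | hge
  · exact key t hst le_rfl hle
  -- After `s + h₀` the whole delay window lies in the hump, so `x` cannot exceed its value there.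
  · have h1 := hx.exp_mul_le_of_nonneg (s := s + h₀) (by linarith) hge
      (fun u hu => hpos u ⟨by linarith [hu.1], hu.2⟩)
    have h2 : 0 ≤ x (s + h₀) := hpos _ ⟨by linarith, hge⟩
    have h3 : Real.exp (τ (s + h₀)) ≤ Real.exp (τ t) := Real.exp_le_exp.2 (hx.time_mono ha hge)
    have h4 : Real.exp (τ t) * x t ≤ Real.exp (τ t) * x (s + h₀) :=
      h1.trans (by gcongr)
    exact (le_of_mul_le_mul_left h4 (Real.exp_pos _)).trans
      (key _ (by linarith) hge le_rfl)

theorem tendsto_zero_of_pos (hx : IsDelayComparable x τ a₀ A b₀ h₀ T₀) (ha : 0 < a₀)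
    (hpos : ∀ᶠ t in atTop, 0 < x t) : Tendsto x atTop (𝓝 0) := by
  obtain ⟨N, hN⟩ := eventually_atTop.1 hpos
  set s := max T₀ N + h₀ with hs
  have hτ : Tendsto τ atTop atTop := by
    have h1 : Tendsto (fun t => a₀ * (t - s) + τ s) atTop atTop :=
      tendsto_atTop_add_const_right _ _
        ((tendsto_atTop_add_const_right _ (-s) tendsto_id).const_mul_atTop ha)
    refine tendsto_atTop_mono' _ ?_ h1
    filter_upwards [eventually_ge_atTop s] with t ht
    linarith [hx.time_lower s t ht]
  have hlim : Tendsto (fun t => Real.exp (τ s) * x s * Real.exp (-τ t)) atTop (𝓝 0) := by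
    simpa using (Real.tendsto_exp_neg_atTop_nhds_zero.comp hτ).const_mul (Real.exp (τ s) * x s)
  refine squeeze_zero' (hpos.mono fun t ht => ht.le) ?_ hlim
  filter_upwards [eventually_ge_atTop s] with t ht
  have h1 := hx.exp_mul_le_of_nonneg (s := s) (by linarith [le_max_left T₀ N]) ht
    (fun u hu => (hN u (by linarith [hu.1, le_max_right T₀ N])).le)
  calc x t = Real.exp (τ t) * x t * Real.exp (-τ t) := by
        rw [mul_right_comm, ← Real.exp_add]; simp
    _ ≤ _ := by gcongr

/-- The trichotomy between eventually positive, eventually negative and oscillating functions. -/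
theorem eventually_pos_or_neg_or_frequently_zero (hx : ContinuousOn x (Ici T₀)) :
    (∀ᶠ t in atTop, 0 < x t) ∨ (∀ᶠ t in atTop, x t < 0) ∨ ∀ N, ∃ s, N ≤ s ∧ x s = 0 := by
  by_cases h : ∀ N, ∃ s, N ≤ s ∧ x s = 0
  · exact Or.inr (Or.inr h)
  push Not at h
  obtain ⟨N, hN⟩ := h
  have hivt : ∀ s t, max T₀ N ≤ s → s ≤ t → (0 < x s ↔ 0 < x t) := by
    intro s t hs hst
    have hc : ContinuousOn x (Icc s t) :=
      hx.mono fun u hu => (le_max_left _ _).trans (hs.trans hu.1)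
    by_contra hne
    have h0 : (0 : ℝ) ∈ x '' Icc s t := by
      rcases lt_or_ge 0 (x s) with h1 | h1
      · exact intermediate_value_Icc' hst hc ⟨by by_contra! h2; simp [h1, h2] at hne, h1.le⟩
      · exact intermediate_value_Icc hst hc
          ⟨h1, by by_contra! h2; exact hne ⟨fun h => by linarith, fun h => by linarith⟩⟩
    obtain ⟨z, hz, hz0⟩ := h0
    exact hN z ((le_max_right _ _).trans (hs.trans hz.1)) hz0
  rcases lt_or_ge 0 (x (max T₀ N)) with h1 | h1
  · exact Or.inl ((eventually_ge_atTop _).mono fun t ht => (hivt _ t le_rfl ht).1 h1)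
  · refine Or.inr (Or.inl ((eventually_ge_atTop (max T₀ N)).mono fun t ht => ?_))
    refine lt_of_le_of_ne (not_lt.1 fun h2 => ?_) (hN t ((le_max_right _ _).trans ht))
    exact absurd ((hivt _ t le_rfl ht).2 h2) (not_lt.2 h1)

theorem tendsto_zero (hx : IsDelayComparable x τ a₀ A b₀ h₀ T₀)
    (hx' : IsDelayComparable (fun t => -x t) τ a₀ A b₀ h₀ T₀) (ha : 0 < a₀) (hA : 0 < A)
    (hb : 0 < b₀) (h₀0 : 0 ≤ h₀) (hbdd : ∃ m, 0 ≤ m ∧ ∀ᶠ t in atTop, |x t| ≤ m)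
    (hcond : Real.log ((b₀ ^ 2 + a₀ * b₀) / (b₀ ^ 2 + a₀ ^ 2))
      < a₀ / b₀ * Real.exp (-(A * h₀))) : Tendsto x atTop (𝓝 0) := by
  rcases eventually_pos_or_neg_or_frequently_zero hx.continuousOn with h | h | hzero
  · exact hx.tendsto_zero_of_pos ha h
  · simpa using (hx'.tendsto_zero_of_pos ha (h.mono fun t ht => neg_pos.2 ht)).neg
  obtain ⟨β, hβ⟩ : ∃ β, β = b₀ / a₀ := ⟨_, rfl⟩
  obtain ⟨H, hH⟩ : ∃ H, H = max (A * h₀) (Real.log (1 + 1 / β)) := ⟨_, rfl⟩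
  obtain ⟨ε, hε⟩ : ∃ ε, ε = Real.exp (-H) / β := ⟨_, rfl⟩
  obtain ⟨K, hK⟩ : ∃ K, K = max ((β ^ 2 + β) * Real.exp (-ε) - β ^ 2) 0 := ⟨_, rfl⟩
  have hβ0 : 0 < β := hβ ▸ div_pos hb ha
  have hK0 : 0 ≤ K := hK ▸ le_max_right _ _
  have hK1 : K < 1 := by
    rw [hK]
    refine max_lt (contraction_factor_lt_one hβ0 ?_) one_pos
    rw [hε, hH]
    refine log_lt_exp_neg_max hβ0 ?_
    have e1 : (β ^ 2 + β) / (β ^ 2 + 1) = (b₀ ^ 2 + a₀ * b₀) / (b₀ ^ 2 + a₀ ^ 2) := by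
      rw [hβ]; field_simp
    have e2 : Real.exp (-(A * h₀)) / β = a₀ / b₀ * Real.exp (-(A * h₀)) := by
      rw [hβ]; field_simp
    rwa [e1, e2]
  obtain ⟨m, hm, hbd⟩ := hbdd
  have hiter : ∀ n : ℕ, ∀ᶠ t in atTop, |x t| ≤ K ^ n * m := by
    intro n
    induction n with
    | zero => simpa using hbd
    | succ n ih =>
      obtain ⟨N, hN⟩ := eventually_atTop.1 ih
      obtain ⟨s, hs, hxs⟩ := hzero (max T₀ N + 2 * h₀)
      have hN' : ∀ u, max T₀ N ≤ u → |x u| ≤ K ^ n * m :=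
        fun u hu => hN u ((le_max_right _ _).trans hu)
      have hKm : 0 ≤ K ^ n * m := by positivity
      filter_upwards [eventually_ge_atTop s] with t ht
      have h1 := hx.le_contraction_mul ha hA hb hβ hH hε (le_max_left T₀ N) hKm
        (fun u hu => (abs_le.1 (hN' u hu)).1) hs h₀0 hxs ht
      have h2 := hx'.le_contraction_mul ha hA hb hβ hH hε (le_max_left T₀ N) hKm
        (fun u hu => neg_le_neg (abs_le.1 (hN' u hu)).2) hs h₀0 (by simp [hxs]) ht
      rw [← hK] at h1 h2
      rw [pow_succ', mul_assoc, abs_le]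
      exact ⟨by linarith, h1⟩
  have hlim : Tendsto (fun n : ℕ => K ^ n * m) atTop (𝓝 0) := by
    simpa using (tendsto_pow_atTop_nhds_zero_of_lt_one hK0 hK1).mul_const m
  rw [Metric.tendsto_nhds]
  intro δ hδ
  obtain ⟨n, hn⟩ := (hlim.eventually (gt_mem_nhds hδ)).exists
  filter_upwards [hiter n] with t ht
  rw [Real.dist_eq, sub_zero]
  exact ht.trans_lt hn

end IsDelayComparable

/-! ### Reduction of the delay equation to the comparison problem -/

/-- `0 ≤ C` serves twice: the mass may be less than one, and a nonintegrable `g` has integral `0` by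
convention. -/
theorem setIntegral_le_of_measure_le_one {μ : Measure ℝ} {S : Set ℝ} {g : ℝ → ℝ} {C : ℝ}
    (hS : MeasurableSet S) (hμ : μ S ≤ 1) (hC : 0 ≤ C) (hg : ∀ s ∈ S, g s ≤ C) :
    ∫ s in S, g s ∂μ ≤ C := by
  by_cases hi : IntegrableOn g S μ
  · have hfin : μ S ≠ ⊤ := ne_top_of_le_ne_top ENNReal.one_ne_top hμ
    have h1 : ∫ s in S, g s ∂μ ≤ ∫ _ in S, C ∂μ :=
      setIntegral_mono_on hi (integrableOn_const hfin) hS hg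
    refine h1.trans ?_
    rw [setIntegral_const, smul_eq_mul]
    have h2 : μ.real S ≤ 1 := ENNReal.toReal_le_of_le_ofReal one_pos.le (by simpa using hμ)
    nlinarith
  · rwa [integral_undef hi]

theorem le_setIntegral_of_measure_le_one {μ : Measure ℝ} {S : Set ℝ} {g : ℝ → ℝ} {C : ℝ}
    (hS : MeasurableSet S) (hμ : μ S ≤ 1) (hC : 0 ≤ C) (hg : ∀ s ∈ S, -C ≤ g s) :
    -C ≤ ∫ s in S, g s ∂μ := by
  have := setIntegral_le_of_measure_le_one (g := fun s => -g s) hS hμ hC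
    (fun s hs => by linarith [hg s hs])
  rw [integral_neg] at this
  linarith

/-- The change of time `τ = ∫ a`. -/
theorem exists_time_change {a : ℝ → ℝ} {a₀ A : ℝ} (ha : Measurable a) (ha₀ : 0 ≤ a₀)
    (hlo : ∀ t, a₀ ≤ a t) (hhi : ∀ t, a t ≤ A) :
    ∃ τ : ℝ → ℝ, LipschitzWith A.toNNReal τ ∧ (∀ᵐ r, HasDerivAt τ (a r) r) ∧
      (∀ s t, s ≤ t → a₀ * (t - s) ≤ τ t - τ s) ∧ ∀ s t, s ≤ t → τ t - τ s ≤ A * (t - s) := by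
  have hA : 0 ≤ A := ha₀.trans ((hlo 0).trans (hhi 0))
  have hbd : ∀ t, ‖a t‖ ≤ A := fun t => by
    rw [Real.norm_of_nonneg (ha₀.trans (hlo t))]; exact hhi t
  have hloc : LocallyIntegrable a volume :=
    (locallyIntegrable_const A).mono ha.aestronglyMeasurable
      (Eventually.of_forall fun t => by rw [Real.norm_of_nonneg hA]; exact hbd t)
  have hint : ∀ s t, IntervalIntegrable a volume s t := fun s t =>
    (hloc.integrableOn_isCompact isCompact_uIcc).intervalIntegrable
  have hsub : ∀ s t, (∫ r in (0 : ℝ)..t, a r) - ∫ r in (0 : ℝ)..s, a r = ∫ r in s..t, a r :=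
    fun s t => intervalIntegral.integral_interval_sub_left (hint 0 t) (hint 0 s)
  refine ⟨fun t => ∫ r in (0 : ℝ)..t, a r, ?_, ?_, ?_, ?_⟩
  · refine LipschitzWith.of_dist_le_mul fun t s => ?_
    rw [dist_eq_norm, hsub, Real.coe_toNNReal A hA, Real.dist_eq]
    exact intervalIntegral.norm_integral_le_of_norm_le_const fun r _ => hbd r
  · filter_upwards [LocallyIntegrable.ae_hasDerivAt_integral hloc] with r hr using hr 0
  · intro s t hst
    have := intervalIntegral.integral_mono_on hst intervalIntegrable_const (hint s t)
      (fun r _ => hlo r)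
    rw [hsub]
    simpa [mul_comm] using this
  · intro s t hst
    have := intervalIntegral.integral_mono_on hst (hint s t) intervalIntegrable_const
      (fun r _ => hhi r)
    rw [hsub]
    simpa [mul_comm] using this

theorem continuousOn_Ici_of_absolutelyContinuousOnInterval {x : ℝ → ℝ} {T₀ : ℝ}
    (hx : ∀ s t, T₀ ≤ s → s ≤ t → AbsolutelyContinuousOnInterval x s t) :
    ContinuousOn x (Ici T₀) := by
  intro t ht
  have h1 := (hx T₀ (t + 1) le_rfl (by linarith [mem_Ici.1 ht])).continuousOn
  rw [uIcc_of_le (by linarith [mem_Ici.1 ht])] at h1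
  refine (h1 t ⟨ht, by linarith⟩).mono_of_mem_nhdsWithin ?_
  rw [← Ici_inter_Iic]
  exact inter_mem_nhdsWithin _ (Iic_mem_nhds (by linarith))

theorem IsDelayComparable.of_ae_hasDerivAt {x τ a F : ℝ → ℝ} {L : NNReal} {a₀ A b₀ h₀ T₀ : ℝ}
    (ha₀ : 0 < a₀) (hb₀ : 0 ≤ b₀) (h₀0 : 0 ≤ h₀)
    (hx : ∀ s t, T₀ ≤ s → s ≤ t → AbsolutelyContinuousOnInterval x s t)
    (hτL : LipschitzWith L τ) (hτ' : ∀ᵐ r, HasDerivAt τ (a r) r)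
    (hτlo : ∀ s t, s ≤ t → a₀ * (t - s) ≤ τ t - τ s)
    (hτhi : ∀ s t, s ≤ t → τ t - τ s ≤ A * (t - s)) (hlo : ∀ t, a₀ ≤ a t)
    (hx' : ∀ᵐ r, T₀ + h₀ ≤ r → HasDerivAt x (-(a r * x r) - F r) r)
    (hF : ∀ᵐ r, T₀ + h₀ ≤ r → ∀ c, 0 ≤ c → (∀ u ∈ Icc (r - h₀) r, -c ≤ x u) →
      -(b₀ * c) ≤ F r) : IsDelayComparable x τ a₀ A b₀ h₀ T₀ where
  continuousOn := continuousOn_Ici_of_absolutelyContinuousOnInterval hx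
  time_lower := hτlo
  time_upper := hτhi
  time_continuous := hτL.continuous
  weighted_le := fun p q s t hs hst hc => by
    refine exp_weighted_le (F := F) hst (hx s t (by linarith) hst) hτL hτ' ?_ ?_
    · filter_upwards [hx'] with r hr hrs using hr (hs.trans hrs.1)
    · filter_upwards [hF] with r hr hrs
      obtain ⟨c, hc0, hcx, hcb⟩ := hc r hrs
      have h1 := hr (hs.trans hrs.1) c hc0 hcx
      -- Nonnegativity allows `a₀` to be replaced by the larger `a r`.
      have h2 : 0 ≤ p + q * Real.exp (-τ r) := by
        by_contra! h
        nlinarith [mul_nonneg hb₀ hc0]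
      nlinarith [mul_le_mul_of_nonneg_right (hlo r) h2]

theorem IsSignPreserving.nonneg {g : ℝ → ℝ → ℝ} (hg : IsSignPreserving g) {t u : ℝ} (ht : 0 ≤ t)
    (hu : 0 ≤ u) : 0 ≤ g t u := by
  rcases hu.eq_or_lt with rfl | hu
  · exact (hg.zero t ht).ge
  · exact (pos_of_mul_pos_left (hg.pos t ht u hu.ne') hu.le).le

theorem IsSignPreserving.nonpos {g : ℝ → ℝ → ℝ} (hg : IsSignPreserving g) {t u : ℝ} (ht : 0 ≤ t)
    (hu : u ≤ 0) : g t u ≤ 0 := by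
  rcases hu.eq_or_lt with rfl | hu
  · exact (hg.zero t ht).le
  · by_contra! h
    nlinarith [hg.pos t ht u hu.ne]

theorem IsSignPreserving.le_mul {g : ℝ → ℝ → ℝ} (hg : IsSignPreserving g) {t u b c x₁ x₂ : ℝ}
    (ht : 0 ≤ t) (hb : 0 ≤ b) (hgb : ∀ u, x₁ ≤ u → u ≤ x₂ → u ≠ 0 → g t u / u ≤ b)
    (hu₁ : x₁ ≤ u) (hu₂ : u ≤ x₂) (hc : 0 ≤ c) (huc : u ≤ c) : g t u ≤ b * c := by
  rcases le_or_gt u 0 with hu | hu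
  · exact (hg.nonpos ht hu).trans (by positivity)
  · have := hgb u hu₁ hu₂ hu.ne'
    rw [div_le_iff₀ hu] at this
    exact this.trans (by gcongr)

theorem IsSignPreserving.neg_mul_le {g : ℝ → ℝ → ℝ} (hg : IsSignPreserving g)
    {t u b c x₁ x₂ : ℝ} (ht : 0 ≤ t) (hb : 0 ≤ b)
    (hgb : ∀ u, x₁ ≤ u → u ≤ x₂ → u ≠ 0 → g t u / u ≤ b)
    (hu₁ : x₁ ≤ u) (hu₂ : u ≤ x₂) (hc : 0 ≤ c) (huc : -c ≤ u) : -(b * c) ≤ g t u := by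
  rcases le_or_gt 0 u with hu | hu
  · exact le_trans (by linarith [mul_nonneg hb hc]) (hg.nonneg ht hu)
  · have := hgb u hu₁ hu₂ hu.ne
    rw [div_le_iff_of_neg hu] at this
    nlinarith

/-- The quotient `f (t, x t) / x t`, continued by a constant to the zeros of `x` and to the left
of `T₀`, is a bounded measurable coefficient. -/
theorem exists_coefficient {f : ℝ → ℝ → ℝ} {x : ℝ → ℝ} {a₀ A T₀ x₁ x₂ : ℝ}
    (hf : IsSignPreserving f) (hT₀ : 0 ≤ T₀) (hx : ContinuousOn x (Ici T₀)) (haA : a₀ ≤ A)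
    (hbd : ∀ t, T₀ ≤ t → x₁ ≤ x t ∧ x t ≤ x₂)
    (hfb : ∀ t, 0 ≤ t → ∀ u, x₁ ≤ u → u ≤ x₂ → u ≠ 0 → a₀ ≤ f t u / u ∧ f t u / u ≤ A) :
    ∃ a : ℝ → ℝ, Measurable a ∧ (∀ t, a₀ ≤ a t) ∧ (∀ t, a t ≤ A) ∧
      ∀ t, T₀ ≤ t → f t (x t) = a t * x t := by
  classical
  -- Freezing time at `T₀` on the left gives functions continuous on all of `ℝ`.
  have hmax : Continuous fun t : ℝ => max t T₀ := continuous_id.max continuous_const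
  have hxc : Continuous fun t => x (max t T₀) :=
    hx.comp_continuous hmax fun t => mem_Ici.2 (le_max_right _ _)
  have hfc : Continuous fun t => f (max t T₀) (x (max t T₀)) :=
    hf.continuousOn.comp_continuous (hmax.prodMk hxc)
      fun t => ⟨hT₀.trans (le_max_right _ _), mem_univ _⟩
  have hb : ∀ t, x (max t T₀) ≠ 0 → a₀ ≤ f (max t T₀) (x (max t T₀)) / x (max t T₀) ∧
      f (max t T₀) (x (max t T₀)) / x (max t T₀) ≤ A := fun t ht =>
    hfb _ (hT₀.trans (le_max_right _ _)) _ (hbd _ (le_max_right _ _)).1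
      (hbd _ (le_max_right _ _)).2 ht
  refine ⟨fun t => if x (max t T₀) = 0 then a₀ else f (max t T₀) (x (max t T₀)) / x (max t T₀),
    Measurable.ite (hxc.measurable (measurableSet_singleton 0)) measurable_const
      (hfc.measurable.div hxc.measurable), fun t => ?_, fun t => ?_, fun t ht => ?_⟩
  · dsimp only
    split_ifs with h
    exacts [le_rfl, (hb t h).1]
  · dsimp only
    split_ifs with h
    exacts [haA, (hb t h).2]
  · simp only [max_eq_left ht]
    split_ifs with h
    · rw [h, hf.zero t (hT₀.trans ht), mul_zero]
    · rw [div_mul_cancel₀ _ h]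

theorem theorem6 (m : ℕ) (f : ℝ → ℝ → ℝ) (g : Fin m → ℝ → ℝ → ℝ) (h : Fin m → ℝ → ℝ)
    (R : Fin m → ℝ → ℝ → ℝ)
    (x₁₀ x₂₀ : EReal) (x₁ x₂ : ℝ) (a₀ A h₀ b₀ : ℝ) (b : Fin m → ℝ)
    -- the delays
    (hh : ∀ k, IsDelayedArgument (h k))
    -- the kernels
    (hR : ∀ k, ∀ᵐ t ∂(volume.restrict (Ici (0 : ℝ))), Monotone (R k t) ∧
      lebesgueStieltjes (R k t) (Icc (max 0 (h k t)) t) ≤ 1)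
    -- the nonlinearities
    (hf : IsSignPreserving f) (hg : ∀ k, IsSignPreserving (g k))
    -- unique global solvability and boundedness of the solutions
    (hx₁₀ : x₁₀ ≤ 0) (hx₂₀ : 0 ≤ x₂₀) (hx₁ : x₁ ≤ 0) (hx₂ : 0 ≤ x₂)
    (hsol : ∀ φ : ℝ → ℝ, IsAdmissibleInitial x₁₀ x₂₀ φ →
      (∃! x : ℝ → ℝ, IsSolution f g h R φ x) ∧
      ∀ x : ℝ → ℝ, IsSolution f g h R φ x → ∀ᶠ t in atTop, x₁ ≤ x t ∧ x t ≤ x₂)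
    -- the estimates
    (ha₀ : 0 < a₀) (hA : 0 < A) (hb : ∀ k, 0 < b k)
    (hfb : ∀ t, 0 ≤ t → ∀ u, x₁ ≤ u → u ≤ x₂ → u ≠ 0 → a₀ ≤ f t u / u ∧ f t u / u ≤ A)
    (hgb : ∀ k, ∀ t, 0 ≤ t → ∀ u, x₁ ≤ u → u ≤ x₂ → u ≠ 0 →
      0 ≤ g k t u / u ∧ g k t u / u ≤ b k)
    (hh₀ : ∀ k, ∀ t, 0 ≤ t → t - h k t ≤ h₀)
    (hb₀ : b₀ = ∑ k, b k)
    (hineq : a₀ / b₀ * Real.exp (-(A * h₀)) >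
      Real.log ((b₀ ^ 2 + a₀ * b₀) / (b₀ ^ 2 + a₀ ^ 2))) :
    ∀ φ : ℝ → ℝ, IsAdmissibleInitial x₁₀ x₂₀ φ →
      ∀ x : ℝ → ℝ, IsSolution f g h R φ x → Tendsto x atTop (𝓝 0) := by
  intro φ hφ x hsolx
  have hb₀n : 0 ≤ b₀ := hb₀ ▸ Finset.sum_nonneg fun k _ => (hb k).le
  have hb₀pos : 0 < b₀ := by
    refine hb₀n.lt_of_ne' fun h => ?_
    -- For `b₀ = 0` both sides of the inequality are `0`, by the conventions `a₀ / 0 = 0` and `log 0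
    -- = 0`.
    simp [h] at hineq
  obtain ⟨k₀⟩ : Nonempty (Fin m) := by
    by_contra hne
    rw [not_nonempty_iff] at hne
    simp [hb₀] at hb₀pos
  have h₀0 : 0 ≤ h₀ := by
    linarith [hh₀ k₀ 0 le_rfl, (hh k₀).le_self 0 le_rfl]
  obtain ⟨N, hN⟩ := eventually_atTop.1 ((hsol φ hφ).2 x hsolx)
  set T₀ := max N 0
  have hT₀ : 0 ≤ T₀ := le_max_right _ _
  have hbd : ∀ t, T₀ ≤ t → x₁ ≤ x t ∧ x t ≤ x₂ := fun t ht => hN t ((le_max_left _ _).trans ht)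
  have hac : ∀ s t, T₀ ≤ s → s ≤ t → AbsolutelyContinuousOnInterval x s t := by
    intro s t hs hst
    refine (hsolx.absolutelyContinuous t (by linarith)).mono ?_
    rw [uIcc_of_le hst, uIcc_of_le (by linarith)]
    exact Icc_subset_Icc_left (by linarith)
  have hcont := continuousOn_Ici_of_absolutelyContinuousOnInterval hac
  have hbounded : ∃ M, 0 ≤ M ∧ ∀ᶠ t in atTop, |x t| ≤ M := by
    refine ⟨x₂ - x₁, by linarith, ?_⟩
    filter_upwards [eventually_ge_atTop T₀] with t ht
    rw [abs_le]
    constructor <;> linarith [(hbd t ht).1, (hbd t ht).2]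
  by_cases haA : a₀ ≤ A
  swap
  · -- then `[x₁, x₂]` is reduced to `0`
    have hzero : ∀ u, x₁ ≤ u → u ≤ x₂ → u = 0 := fun u h1 h2 => by
      by_contra h
      exact haA ((hfb 0 le_rfl u h1 h2 h).1.trans (hfb 0 le_rfl u h1 h2 h).2)
    refine tendsto_const_nhds.congr' ?_
    filter_upwards [eventually_ge_atTop T₀] with t ht
    exact (hzero _ (hbd t ht).1 (hbd t ht).2).symm
  obtain ⟨a, ham, hlo, hhi, hfa⟩ := exists_coefficient hf hT₀ hcont haA hbd hfb
  obtain ⟨τ, hτL, hτ', hτlo, hτhi⟩ := exists_time_change ham ha₀.le hlo hhi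
  set F : ℝ → ℝ := fun t => ∑ k, ∫ s in Icc (h k t) t, g k t (x s) ∂(lebesgueStieltjes (R k t))
  have hx' : ∀ᵐ r, T₀ + h₀ ≤ r → HasDerivAt x (-(a r * x r) - F r) r := by
    have h1 := hsolx.equation
    rw [ae_restrict_iff' measurableSet_Ici] at h1
    filter_upwards [h1] with r hr hrT
    obtain ⟨x', hd, he⟩ := hr (mem_Ici.2 (by linarith))
    rw [hfa r (by linarith)] at he
    have : -(a r * x r) - F r = x' := by linarith
    rwa [this]
  have hkernel : ∀ᵐ r, T₀ + h₀ ≤ r → ∀ k,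
      lebesgueStieltjes (R k r) (Icc (h k r) r) ≤ 1 := by
    have h1 := ae_all_iff.2 hR
    rw [ae_restrict_iff' measurableSet_Ici] at h1
    filter_upwards [h1] with r hr hrT k
    have h2 := (hr (mem_Ici.2 (by linarith)) k).2
    -- Past `T₀ + h₀` the delayed argument is nonnegative, so the mass bound covers the full window.
    rwa [max_eq_right (by linarith [hh₀ k r (by linarith)])] at h2
  have hmem : ∀ r, T₀ + h₀ ≤ r → ∀ k, ∀ s ∈ Icc (h k r) r, s ∈ Icc (r - h₀) r ∧ T₀ ≤ s := by
    intro r hr k s hs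
    have h1 := hh₀ k r (by linarith)
    exact ⟨⟨by linarith [hs.1], hs.2⟩, by linarith [hs.1]⟩
  have hFlo : ∀ᵐ r, T₀ + h₀ ≤ r → ∀ c, 0 ≤ c → (∀ u ∈ Icc (r - h₀) r, -c ≤ x u) →
      -(b₀ * c) ≤ F r := by
    filter_upwards [hkernel] with r hr hrT c hc hcx
    rw [hb₀, Finset.sum_mul, ← Finset.sum_neg_distrib]
    refine Finset.sum_le_sum fun k _ => le_setIntegral_of_measure_le_one measurableSet_Icc
      (hr hrT k) (mul_nonneg (hb k).le hc) fun s hs => ?_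
    obtain ⟨h1, h2⟩ := hmem r hrT k s hs
    exact (hg k).neg_mul_le (by linarith) (hb k).le
      (fun u hu₁ hu₂ hu => (hgb k r (by linarith) u hu₁ hu₂ hu).2) (hbd s h2).1 (hbd s h2).2 hc
      (hcx s h1)
  have hFhi : ∀ᵐ r, T₀ + h₀ ≤ r → ∀ c, 0 ≤ c → (∀ u ∈ Icc (r - h₀) r, -c ≤ -x u) →
      -(b₀ * c) ≤ -F r := by
    filter_upwards [hkernel] with r hr hrT c hc hcx
    rw [neg_le_neg_iff, hb₀, Finset.sum_mul]
    refine Finset.sum_le_sum fun k _ => setIntegral_le_of_measure_le_one measurableSet_Icc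
      (hr hrT k) (mul_nonneg (hb k).le hc) fun s hs => ?_
    obtain ⟨h1, h2⟩ := hmem r hrT k s hs
    exact (hg k).le_mul (by linarith) (hb k).le
      (fun u hu₁ hu₂ hu => (hgb k r (by linarith) u hu₁ hu₂ hu).2) (hbd s h2).1 (hbd s h2).2 hc
      (by linarith [hcx s h1])
  refine (IsDelayComparable.of_ae_hasDerivAt ha₀ hb₀n h₀0 hac hτL hτ' hτlo hτhi hlo hx'
    hFlo).tendsto_zero
    (IsDelayComparable.of_ae_hasDerivAt (F := fun r => -F r) ha₀ hb₀n h₀0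
      (fun s t hs hst => (hac s t hs hst).neg) hτL hτ' hτlo hτhi hlo ?_ hFhi)
    ha₀ hA hb₀pos h₀0 hbounded hineq
  filter_upwards [hx'] with r hr hrT
  exact (hr hrT).neg.congr_deriv (by ring)
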